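/- Conventions. A poset is $\kappa^{\mathrm{op}}$-like if no element is below $\kappa$-many elements (that is, $|\{q : p\le q\}|<\kappa$ for every $p$). The Noetherian type of a topological space $X$ is the least infinite cardinal $\kappa$ such that $X$ has a base which, ordered by inclusion, is $\kappa^{\mathrm{op}}$-like. For a cardinal $\mu$, a space is $\mu$-compact if every open cover of it has a subcover of size less than $\mu$. A GO-space is a subspace of a linearly ordered topological space. A weakly inaccessible cardinal is an uncountable regular limit cardinal, and a strongly inaccessible cardinal is an uncountable regular strong limit cardinal. Theorem. Let $\kappa$ be a weakly inaccessible cardinal and $\mu$ a cardinal such that $|\lambda^{<\mu}|<\kappa$ for every cardinal $\lambda<\kappa$. If $X=\prod_{i\in I}X_i$ (with the product topology) where $|I|<\kappa$ and every $X_i$ is a $\mu$-compact GO-space, then the Noetherian type of $X$ is not $\kappa$. In particular, the Noetherian type of a Lindelöf GO-space is never strongly inaccessible. -/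

import Mathlib

open Cardinal TopologicalSpace

universe u

/-- A poset is `κ^op`-like if no element is below `κ`-many elements. -/
def IsOpLike (κ : Cardinal.{u}) (P : Type u) [PartialOrder P] : Prop :=
  ∀ p : P, ¬ κ ≤ #{q : P // p ≤ q}

/-- `X` has a base that is `κ^op`-like (as a family of sets ordered by inclusion). -/
def HasOpLikeBase (κ : Cardinal.{u}) (X : Type u) [TopologicalSpace X] : Prop :=
  ∃ B : Set (Set X), IsTopologicalBasis B ∧ IsOpLike κ B

/-- The Noetherian type of `X`: the least infinite cardinal `κ` such that `X` has a
`κ^op`-like base. -/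
noncomputable def noetherianType (X : Type u) [TopologicalSpace X] : Cardinal.{u} :=
  sInf {κ : Cardinal.{u} | ℵ₀ ≤ κ ∧ HasOpLikeBase κ X}

/-- The minimum defining the Noetherian type is attained: it is not a minimum over the
empty set. -/
theorem noetherianType_mem (X : Type u) [TopologicalSpace X] :
    ℵ₀ ≤ noetherianType X ∧ HasOpLikeBase (noetherianType X) X := by
  have hne : {κ : Cardinal.{u} | ℵ₀ ≤ κ ∧ HasOpLikeBase κ X}.Nonempty := by
    refine ⟨max ℵ₀ (Order.succ #(Set X)), le_max_left _ _, {s | IsOpen s},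
      isTopologicalBasis_opens, fun p h => ?_⟩
    have h1 : #{q : {s : Set X | IsOpen s} // p ≤ q} ≤ #(Set X) :=
      (mk_subtype_le _).trans (mk_set_le _)
    exact absurd ((le_max_right _ _).trans (h.trans h1)) (not_le.2 (Order.lt_succ _))
  exact csInf_mem hne

/-- `X` is `μ`-compact: every open cover of `X` has a subcover of size less than `μ`. -/
def IsCardCompact (μ : Cardinal.{u}) (X : Type u) [TopologicalSpace X] : Prop :=
  ∀ C : Set (Set X), (∀ U ∈ C, IsOpen U) → ⋃₀ C = Set.univ →
    ∃ D : Set (Set X), D ⊆ C ∧ ⋃₀ D = Set.univ ∧ #D < μ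

/-- A GO-space (generalized ordered space) is a subspace of a linearly ordered
topological space. -/
def IsGOSpace (X : Type u) [TopologicalSpace X] : Prop :=
  ∃ (Y : Type u) (_ : LinearOrder Y) (_ : TopologicalSpace Y) (_ : OrderTopology Y)
    (f : X → Y), Topology.IsEmbedding f

/-- A weakly inaccessible cardinal is an uncountable regular limit cardinal. -/
def IsWeaklyInaccessible (κ : Cardinal.{u}) : Prop :=
  ℵ₀ < κ ∧ κ.IsRegular ∧ Order.IsSuccLimit κ

open Set Topology

/-! It suffices that every `κ^op`-like base `A` of the product has fewer than `κ` members: since `κ`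
is a limit, the Noetherian type is then below `κ`. Each nonempty open set lies in fewer than `κ`
members of `A`, so a `π`-base of size below `κ` is enough (`mk_base_lt`), and boxes reduce this to a
small `π`-base of each factor.

Close off to a set `D` of fewer than `κ` points of a factor `Y` so that small subsets of `D` are
separated within `D` whenever possible. If `D` is dense, intervals and isolated points from `D` form
a `π`-base. If not, `μ`-compactness yields, up to reversing the order, a gap: a point `l` that is a
left limit of `D` while `D` misses some `[l, p)`. Intervals from `D` still form a local `π`-base at
`l`, so every factor has a point of small `π`-character, and so has the product `Z` of the other
factors, at some `y`.

Now `A` excludes the gap. Members of `A` around `(l, y)` contain boxes coded by `D`, and few members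
contain a given box, so `D` can also be closed under picking points from these members. Some picked
point would lie in `[l, p)` (`IsLeftGap.exists_dominates`). Hence this larger `D` is dense. -/

/-! ### Cardinal arithmetic and closing off. -/

theorem mk_biUnion_lt {κ : Cardinal.{u}} (hκ : κ.IsRegular) {α β : Type u} {s : Set α}
    {t : α → Set β} (hs : #s < κ) (ht : ∀ a ∈ s, #(t a) < κ) : #(⋃ a ∈ s, t a : Set β) < κ :=
  (card_biUnion_lt_iff_forall_of_isRegular hκ hs).2 ht

theorem mk_iUnion_lt {κ : Cardinal.{u}} (hκ : κ.IsRegular) {α β : Type u}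
    {t : α → Set β} (hs : #α < κ) (ht : ∀ a, #(t a) < κ) : #(⋃ a, t a : Set β) < κ :=
  (card_iUnion_lt_iff_forall_of_isRegular hκ hs).2 ht

theorem mk_union_lt {κ : Cardinal.{u}} (hκ : ℵ₀ ≤ κ) {β : Type u} {s t : Set β}
    (hs : #s < κ) (ht : #t < κ) : #(s ∪ t : Set β) < κ :=
  (mk_union_le s t).trans_lt (add_lt_of_lt hκ hs ht)

/-- The cardinals below `μ` are represented by the initial segments of `μ.ord`, so regularity of `κ`
reduces the count to one exponent at a time. -/
theorem mk_small_subsets_lt {κ μ : Cardinal.{u}} (hκ : κ.IsRegular) (hμκ : μ < κ)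
    (hpow : ∀ θ < κ, ∀ c < μ, θ ^ c < κ) {Y : Type u} {D : Set Y} (hκ' : ℵ₀ < κ) (hD : #D < κ) :
    #{S : Set Y | S ⊆ D ∧ #S < μ} < κ := by
  have hsub : {S : Set Y | S ⊆ D ∧ #S < μ} ⊆
      ⋃ a : μ.ord.ToType, {S : Set Y | S ⊆ D ∧ #S ≤ #(Iio a)} := by
    rintro S ⟨hSD, hS⟩
    have h : (#S).ord < Ordinal.type (α := μ.ord.ToType) (· < ·) := by
      rw [Ordinal.type_toType]; exact ord_lt_ord.2 hS
    refine mem_iUnion.2 ⟨Ordinal.enum (α := μ.ord.ToType) (· < ·) ⟨_, h⟩, hSD, ?_⟩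
    have := Ordinal.typein_enum (α := μ.ord.ToType) (· < ·) h
    have h2 := congrArg Ordinal.card this
    rw [card_ord] at h2
    exact h2.symm.le
  refine (mk_le_mk_of_subset hsub).trans_lt (mk_iUnion_lt hκ (by rwa [mk_ord_toType]) fun a => ?_)
  exact (mk_bounded_subset_le D _).trans_lt
    (hpow _ (max_lt hD hκ') _ (by simpa using mk_Iio_lt a (by simp)))

/-- Closing off under an operation on pairs of small sets. -/
theorem exists_small_closed_set {κ μ : Cardinal.{u}} (hκ : κ.IsRegular) (hμ : ℵ₀ ≤ μ)
    (hμκ : Order.succ μ < κ) (hpow : ∀ θ < κ, ∀ c < μ, θ ^ c < κ) {Y : Type u}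
    (F : Set Y → Set Y → Set Y) (hF : ∀ S T : Set Y, #S < μ → #T < μ → #(F S T) < κ) :
    ∃ D : Set Y, #D < κ ∧ ∀ S T : Set Y, S ⊆ D → T ⊆ D → #S < μ → #T < μ → F S T ⊆ D := by
  classical
  have hμκ' : μ < κ := (Order.lt_succ μ).trans hμκ
  -- The length is `μ⁺` because `μ` may be singular: regularity of `μ⁺` puts every subset of size
  -- below `μ` inside an earlier stage.
  let J := (Order.succ μ).ord.ToType
  let step : Set Y → Set Y := fun D =>
    ⋃ S ∈ {S : Set Y | S ⊆ D ∧ #S < μ}, ⋃ T ∈ {S : Set Y | S ⊆ D ∧ #S < μ}, F S T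
  let E : J → Set Y := wellFounded_lt.fix fun j f => step (⋃ i : Iio j, f i.1 i.2)
  have hE : ∀ j, E j = step (⋃ i : Iio j, E i.1) := fun j => wellFounded_lt.fix_eq _ j
  have hJ : #J = Order.succ μ := mk_ord_toType _
  have hcard : ∀ j, #(E j) < κ := by
    intro j
    induction j using WellFoundedLT.induction with
    | ind j ih =>
      have h1 : #(⋃ i : Iio j, E i : Set Y) < κ :=
        mk_iUnion_lt (t := fun i : Iio j => E i) hκ
          (((mk_set_le _).trans hJ.le).trans_lt hμκ) fun i => ih i.1 i.2
      have h2 := mk_small_subsets_lt hκ hμκ' hpow (hμ.trans_lt hμκ') h1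
      rw [hE]
      exact mk_biUnion_lt hκ h2 fun S hS => mk_biUnion_lt hκ h2 fun T hT => hF S T hS.2 hT.2
  have hbdd : ∀ S : Set Y, S ⊆ ⋃ j, E j → #S < μ → ∃ j : J, S ⊆ ⋃ i : Iio j, E i.1 := by
    intro S hS hSμ
    choose f hf using fun s : S => mem_iUnion.1 (hS s.2)
    have hnc : ¬ IsCofinal (range f) := by
      intro h
      have h1 := (Order.cof_le h).trans mk_range_le
      rw [Ordinal.cof_toType, (isRegular_succ hμ).cof_ord] at h1
      exact absurd (h1.trans_lt hSμ) (not_lt.2 (Order.le_succ μ))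
    simp only [IsCofinal, not_forall, not_exists, not_and] at hnc
    obtain ⟨j, hj⟩ := hnc
    refine ⟨j, fun s hs => mem_iUnion.2 ⟨⟨f ⟨s, hs⟩, ?_⟩, hf ⟨s, hs⟩⟩⟩
    exact not_le.1 (hj _ (mem_range_self _))
  refine ⟨⋃ j, E j, mk_iUnion_lt hκ (hJ.le.trans_lt hμκ) hcard, fun S T hS hT hSμ hTμ => ?_⟩
  obtain ⟨j, hj⟩ := hbdd S hS hSμ
  obtain ⟨k, hk⟩ := hbdd T hT hTμ
  have hmono : ∀ {a b : J}, a ≤ b → (⋃ i : Iio a, E i.1) ⊆ ⋃ i : Iio b, E i.1 := fun hab x hx => by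
    obtain ⟨i, hi⟩ := mem_iUnion.1 hx
    exact mem_iUnion.2 ⟨⟨i.1, i.2.trans_le hab⟩, hi⟩
  refine subset_trans ?_ (subset_iUnion _ (max j k))
  rw [hE]
  intro z hz
  simp only [step, mem_iUnion, mem_ofPred_eq]
  exact ⟨S, ⟨hj.trans (hmono (le_max_left _ _)), hSμ⟩, T,
    ⟨hk.trans (hmono (le_max_right _ _)), hTμ⟩, hz⟩

/-! ### Generalized ordered spaces and the notions attached to a set `D`. -/

/-- The topology is finer than the order topology and has a base of order-convex sets. -/
class GOTopology (Y : Type u) [LinearOrder Y] [TopologicalSpace Y] : Prop where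
  isOpen_Iio : ∀ a : Y, IsOpen (Iio a)
  isOpen_Ioi : ∀ a : Y, IsOpen (Ioi a)
  exists_ordConnected : ∀ p : Y, ∀ U ∈ 𝓝 p, ∃ O ∈ 𝓝 p, O ⊆ U ∧ O.OrdConnected

instance (Y : Type u) [LinearOrder Y] [TopologicalSpace Y] [h : GOTopology Y] :
    GOTopology Yᵒᵈ where
  isOpen_Iio a := h.isOpen_Ioi (OrderDual.ofDual a)
  isOpen_Ioi a := h.isOpen_Iio (OrderDual.ofDual a)
  exists_ordConnected p U hU := by
    obtain ⟨O, hO, hOU, hc⟩ := h.exists_ordConnected (OrderDual.ofDual p) U hU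
    exact ⟨OrderDual.ofDual ⁻¹' O, hO, hOU, hc.dual⟩

theorem IsGOSpace.exists_linearOrder {X : Type u} [TopologicalSpace X] (h : IsGOSpace X) :
    ∃ _ : LinearOrder X, GOTopology X := by
  obtain ⟨Y, _, _, _, f, hf⟩ := h
  let _ : LinearOrder X := LinearOrder.lift' f hf.injective
  refine ⟨inferInstance, fun a => isOpen_Iio.preimage hf.continuous (t := Iio (f a)),
    fun a => isOpen_Ioi.preimage hf.continuous (t := Ioi (f a)), fun p U hU => ?_⟩
  rw [hf.isInducing.nhds_eq_comap] at hU
  obtain ⟨N, hN, hNU⟩ := hU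
  refine ⟨f ⁻¹' (ordConnectedComponent N (f p)),
    hf.continuous.continuousAt (ordConnectedComponent_mem_nhds.2 hN),
    (preimage_mono ordConnectedComponent_subset).trans hNU, ⟨fun a ha b hb c hc => ?_⟩⟩
  exact (inferInstance : (ordConnectedComponent N (f p)).OrdConnected).out ha hb hc

/-- Every small subset of `L` has a strict upper bound in `L`. -/
def SmallBounded (μ : Cardinal.{u}) {Y : Type u} [LinearOrder Y] (L : Set Y) : Prop :=
  ∀ T ⊆ L, #T < μ → ∃ s ∈ L, ∀ t ∈ T, t < s

/-- `P` consists of nonempty open sets, and every neighbourhood of `x` contains one of them. -/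
def IsLocalPiBase {X : Type u} [TopologicalSpace X] (P : Set (Set X)) (x : X) : Prop :=
  (∀ W ∈ P, IsOpen W ∧ W.Nonempty) ∧ ∀ U ∈ 𝓝 x, ∃ W ∈ P, W ⊆ U

/-- The open nonempty intervals with endpoints in `D` and open singletons of elements of `D`. -/
def basicSets {Y : Type u} [LinearOrder Y] [TopologicalSpace Y] (D : Set Y) : Set (Set Y) :=
  {W | IsOpen W ∧ W.Nonempty ∧ ((∃ a ∈ D, ∃ b ∈ D, W = Ioo a b) ∨ ∃ a ∈ D, W = {a})}

/-- Two small subsets of `D` separated by a point are separated by a point of `D`. -/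
def Splits (μ : Cardinal.{u}) {Y : Type u} [LinearOrder Y] (D : Set Y) : Prop :=
  ∀ S ⊆ D, ∀ T ⊆ D, #S < μ → #T < μ → (∃ p, (∀ s ∈ S, s < p) ∧ ∀ t ∈ T, p < t) →
    ∃ q ∈ D, (∀ s ∈ S, s < q) ∧ ∀ t ∈ T, q < t

/-- `l` is a limit from the left of points of `D`, and `D` does not meet `[l, p)`. -/
def IsLeftGap {Y : Type u} [LinearOrder Y] [TopologicalSpace Y] (D : Set Y) (l p : Y) : Prop :=
  l < p ∧ (∀ d ∈ D, d < p → d < l) ∧ ∀ U ∈ 𝓝 l, ∃ s ∈ D, s < l ∧ Icc s l ⊆ U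

/-- A point satisfying `p`, if there is one. -/
noncomputable def pick {Y : Type u} (p : Y → Prop) : Set Y :=
  open Classical in if h : ∃ c, p c then {h.choose} else ∅

theorem mk_pick_lt {κ : Cardinal.{u}} (hκ : ℵ₀ ≤ κ) {Y : Type u} (p : Y → Prop) :
    #(pick p) < κ := by
  refine lt_of_le_of_lt ?_ (one_lt_aleph0.trans_le hκ)
  unfold pick
  split_ifs <;> simp

theorem exists_of_pick_subset {Y : Type u} {p : Y → Prop} {D : Set Y} (h : pick p ⊆ D)
    (hp : ∃ c, p c) : ∃ c ∈ D, p c := by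
  unfold pick at h
  rw [dif_pos hp] at h
  exact ⟨_, h rfl, hp.choose_spec⟩

/-- A point separating `S` from `T`, if there is one. -/
noncomputable def between {Y : Type u} [LinearOrder Y] (S T : Set Y) : Set Y :=
  pick fun p => (∀ s ∈ S, s < p) ∧ ∀ t ∈ T, p < t

theorem splits_of_between_subset {μ : Cardinal.{u}} {Y : Type u} [LinearOrder Y] {D : Set Y}
    (h : ∀ S T : Set Y, S ⊆ D → T ⊆ D → #S < μ → #T < μ → between S T ⊆ D) : Splits μ D :=
  fun S hS T hT hSμ hTμ hp => exists_of_pick_subset (h S T hS hT hSμ hTμ) hp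

/-! ### Gaps and local `π`-bases in one ordered space. -/

section
variable {Y : Type u} [LinearOrder Y] [TopologicalSpace Y]

theorem mk_basicSets_lt {κ : Cardinal.{u}} (hκ : κ.IsRegular) {D : Set Y} (hD : #D < κ) :
    #(basicSets D) < κ := by
  have h : basicSets D ⊆ (⋃ a ∈ D, Ioo a '' D) ∪ (fun a => {a}) '' D := by
    rintro W ⟨-, -, ⟨a, ha, b, hb, rfl⟩ | ⟨a, ha, rfl⟩⟩
    · exact Or.inl (mem_biUnion ha (mem_image_of_mem _ hb))
    · exact Or.inr (mem_image_of_mem _ ha)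
  refine (mk_le_mk_of_subset h).trans_lt (mk_union_lt hκ.1 ?_ (mk_image_le.trans_lt hD))
  exact mk_biUnion_lt hκ hD fun a _ => mk_image_le.trans_lt hD

theorem basicSets_dual (D : Set Y) :
    basicSets (Y := Yᵒᵈ) (OrderDual.ofDual ⁻¹' D) = basicSets D := by
  ext W
  refine and_congr_right fun _ => and_congr_right fun _ => or_congr ?_ Iff.rfl
  constructor
  · rintro ⟨a, ha, b, hb, rfl⟩
    exact ⟨b, hb, a, ha, Ioo_toDual (a := OrderDual.ofDual a) (b := OrderDual.ofDual b)⟩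
  · rintro ⟨a, ha, b, hb, rfl⟩
    exact ⟨OrderDual.toDual b, hb, OrderDual.toDual a, ha,
      (Ioo_toDual (a := b) (b := a)).symm⟩

variable [GOTopology Y]

/-- Otherwise the upper bounds of `L` form an open set, which together with the rays below points of
`L` covers `Y`. A point of `L` strictly above the endpoints of the rays in a small subcover is left
uncovered, as `L` has no maximum. -/
theorem SmallBounded.exists_limit {μ : Cardinal.{u}} (hμ : ℵ₀ ≤ μ) (hY : IsCardCompact μ Y)
    {L : Set Y} (hL : SmallBounded μ L) :
    ∃ l, (∀ s ∈ L, s < l) ∧ ∀ U ∈ 𝓝 l, ∃ s ∈ L, Icc s l ⊆ U := by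
  have hmax : ∀ s ∈ L, ∃ t ∈ L, s < t := fun s hs => by
    obtain ⟨t, ht, h⟩ := hL {s} (singleton_subset_iff.2 hs)
      (by rw [mk_singleton]; exact one_lt_aleph0.trans_le hμ)
    exact ⟨t, ht, h s rfl⟩
  by_contra! hcon
  have hB : IsOpen (upperBounds L) := by
    refine isOpen_iff_mem_nhds.2 fun b hb => ?_
    have hb' : ∀ s ∈ L, s < b := fun s hs => by
      obtain ⟨t, ht, h⟩ := hmax s hs
      exact h.trans_le (hb ht)
    obtain ⟨U, hU, hUL⟩ := hcon b hb'
    obtain ⟨O, hO, hOU, hc⟩ := GOTopology.exists_ordConnected b U hU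
    refine Filter.mem_of_superset hO fun z hz s hs => ?_
    by_contra! hzs
    have hsO : s ∈ O := hc.out hz (mem_of_mem_nhds hO) ⟨hzs.le, hb hs⟩
    exact hUL s hs ((hc.out hsO (mem_of_mem_nhds hO)).trans hOU)
  obtain ⟨C, hC, hCu, hCμ⟩ := hY (insert (upperBounds L) (Iio '' L))
    (by
      rintro U (rfl | ⟨s, -, rfl⟩)
      · exact hB
      · exact GOTopology.isOpen_Iio s)
    (by
      refine eq_univ_of_forall fun z => ?_
      by_cases hz : z ∈ upperBounds L
      · exact ⟨_, mem_insert _ _, hz⟩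
      · simp only [upperBounds, mem_ofPred_eq, not_forall, not_le] at hz
        obtain ⟨s, hs, hzs⟩ := hz
        exact ⟨Iio s, mem_insert_of_mem _ (mem_image_of_mem _ hs), hzs⟩)
  have hinj : Function.Injective (Iio : Y → Set Y) := Iio_injective
  obtain ⟨s, hs, hlt⟩ := hL {t ∈ L | Iio t ∈ C} (fun t ht => ht.1)
    ((mk_le_of_injective (f := fun t : {t ∈ L | Iio t ∈ C} => (⟨Iio t.1, t.2.2⟩ : C))
      fun a b hab => Subtype.ext (hinj (congrArg Subtype.val hab))).trans_lt hCμ)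
  obtain ⟨U, hUC, hsU⟩ : s ∈ ⋃₀ C := hCu ▸ mem_univ s
  rcases hC hUC with rfl | ⟨t, ht, rfl⟩
  · obtain ⟨t, ht, h⟩ := hmax s hs
    exact absurd (hsU ht) (not_le.2 h)
  · exact lt_asymm hsU (hlt t ⟨ht, hUC⟩)

theorem SmallBounded.exists_isLeftGap {μ : Cardinal.{u}} (hμ : ℵ₀ ≤ μ) (hY : IsCardCompact μ Y)
    {D O : Set Y} {p : Y} (hO : O ∈ 𝓝 p) (hOD : Disjoint O D)
    (hL : SmallBounded μ {d ∈ D | d < p}) : ∃ l, IsLeftGap D l p := by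
  obtain ⟨l, hl, hlim⟩ := hL.exists_limit hμ hY
  have hlp : l ≤ p := by
    by_contra! h
    obtain ⟨s, hs, hsU⟩ := hlim _ ((GOTopology.isOpen_Ioi p).mem_nhds h)
    exact lt_asymm hs.2 (hsU (left_mem_Icc.2 (hl s hs).le))
  have hne : l ≠ p := by
    rintro rfl
    obtain ⟨s, hs, hsU⟩ := hlim _ hO
    exact disjoint_left.1 hOD (hsU (left_mem_Icc.2 (hl s hs).le)) hs.1
  refine ⟨l, hlp.lt_of_ne hne, fun d hd hdp => hl d ⟨hd, hdp⟩, fun U hU => ?_⟩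
  obtain ⟨s, hs, hsU⟩ := hlim U hU
  exact ⟨s, hs.1, hl s hs, hsU⟩

/-- If neither side of `p` is small-bounded, small cofinal and coinitial sets are separated by a
point of `D`, which can lie neither left nor right of `p`, nor at `p`. -/
theorem Splits.exists_gap {μ : Cardinal.{u}} (hμ : ℵ₀ ≤ μ) (hY : IsCardCompact μ Y)
    {D O : Set Y} (hD : Splits μ D) {p : Y} (hO : O ∈ 𝓝 p) (hOD : Disjoint O D) :
    (∃ l, IsLeftGap D l p) ∨
      ∃ l : Yᵒᵈ, IsLeftGap (OrderDual.ofDual ⁻¹' D) l (OrderDual.toDual p) := by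
  by_cases hL : SmallBounded μ {d ∈ D | d < p}
  · exact Or.inl (hL.exists_isLeftGap hμ hY hO hOD)
  by_cases hR : SmallBounded (Y := Yᵒᵈ) μ {d ∈ D | p < d}
  · exact Or.inr (SmallBounded.exists_isLeftGap (Y := Yᵒᵈ) hμ hY hO hOD hR)
  exfalso
  unfold SmallBounded at hL hR
  push Not at hL hR
  obtain ⟨S, hSL, hS, hSc⟩ := hL
  obtain ⟨T, hTR, hT, hTc⟩ := hR
  obtain ⟨q, hq, hSq, hTq⟩ := hD S (fun s hs => (hSL hs).1) T (fun t ht => (hTR ht).1) hS hT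
    ⟨p, fun s hs => (hSL hs).2, fun t ht => (hTR ht).2⟩
  rcases lt_trichotomy q p with h | rfl | h
  · obtain ⟨s, hs, hs'⟩ := hSc q ⟨hq, h⟩
    exact absurd (hSq s hs) (not_lt.2 hs')
  · exact disjoint_left.1 hOD (mem_of_mem_nhds hO) hq
  · obtain ⟨s, hs, hs'⟩ := hTc q ⟨hq, h⟩
    exact absurd (hTq s hs) (not_lt.2 hs')

theorem IsLeftGap.exists_Ioo {D : Set Y} {l p : Y} (h : IsLeftGap D l p) {U : Set Y}
    (hU : U ∈ 𝓝 l) :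
    ∃ a ∈ D, ∃ b ∈ D, a < l ∧ Icc a l ⊆ U ∧ (Ioo a b).Nonempty ∧ Ioo a b ⊆ U := by
  obtain ⟨a, ha, hal, haU⟩ := h.2.2 U hU
  obtain ⟨c, -, hcl, hc⟩ := h.2.2 _ ((GOTopology.isOpen_Ioi a).mem_nhds hal)
  obtain ⟨b, hb, hbl, hb'⟩ := h.2.2 _ ((GOTopology.isOpen_Ioi c).mem_nhds hcl)
  exact ⟨a, ha, b, hb, hal, haU, ⟨c, hc (left_mem_Icc.2 hcl.le), hb' (left_mem_Icc.2 hbl.le)⟩,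
    fun z hz => haU ⟨hz.1.le, hz.2.le.trans hbl.le⟩⟩

theorem isOpen_Ioo_of_GOTopology (a b : Y) : IsOpen (Ioo a b) :=
  (GOTopology.isOpen_Ioi a).inter (GOTopology.isOpen_Iio b)

theorem IsLeftGap.isLocalPiBase {D : Set Y} {l p : Y} (h : IsLeftGap D l p) :
    IsLocalPiBase (basicSets D) l := by
  refine ⟨fun W hW => ⟨hW.1, hW.2.1⟩, fun U hU => ?_⟩
  obtain ⟨a, ha, b, hb, -, -, hne, hU⟩ := h.exists_Ioo hU
  exact ⟨Ioo a b, ⟨isOpen_Ioo_of_GOTopology a b, hne, Or.inl ⟨a, ha, b, hb, rfl⟩⟩, hU⟩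

/-- If no nonempty interval with endpoints in `D` fits near `x`, a point of `D` near `x` has no
neighbours accumulating on either side, so it is isolated. -/
theorem isLocalPiBase_of_dense {D : Set Y} (hD : Dense D) (x : Y) :
    IsLocalPiBase (basicSets D) x := by
  refine ⟨fun W hW => ⟨hW.1, hW.2.1⟩, fun U hU => ?_⟩
  obtain ⟨N, hN, hNU, hNc⟩ := GOTopology.exists_ordConnected x U hU
  obtain ⟨O, hON, hO, hxO⟩ := mem_nhds_iff.1 hN
  by_contra! hcon
  have hIoo : ∀ a ∈ O ∩ D, ∀ b ∈ O ∩ D, ∀ z ∈ Ioo a b, False := fun a ha b hb z hz =>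
    hcon (Ioo a b) ⟨isOpen_Ioo_of_GOTopology a b, ⟨z, hz⟩, Or.inl ⟨a, ha.2, b, hb.2, rfl⟩⟩
      ((Ioo_subset_Icc_self.trans (hNc.out (hON ha.1) (hON hb.1))).trans hNU)
  obtain ⟨d, hdO, hd⟩ := hD.inter_open_nonempty O hO ⟨x, hxO⟩
  obtain ⟨W₁, hW₁, hdW₁, hW₁O, hlt⟩ : ∃ W, IsOpen W ∧ d ∈ W ∧ W ⊆ O ∧ ∀ z ∈ W, ¬ z < d := by
    by_cases h : (O ∩ Iio d).Nonempty
    · obtain ⟨e, ⟨heO, hed⟩, he⟩ :=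
        hD.inter_open_nonempty _ (hO.inter (GOTopology.isOpen_Iio d)) h
      exact ⟨O ∩ Ioi e, hO.inter (GOTopology.isOpen_Ioi e), ⟨hdO, hed⟩, inter_subset_left,
        fun z hz hzd => hIoo e ⟨heO, he⟩ d ⟨hdO, hd⟩ z ⟨hz.2, hzd⟩⟩
    · exact ⟨O, hO, hdO, subset_rfl, fun z hz hzd => h ⟨z, hz, hzd⟩⟩
  obtain ⟨W₂, hW₂, hdW₂, hW₂O, hgt⟩ : ∃ W, IsOpen W ∧ d ∈ W ∧ W ⊆ O ∧ ∀ z ∈ W, ¬ d < z := by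
    by_cases h : (O ∩ Ioi d).Nonempty
    · obtain ⟨e, ⟨heO, hed⟩, he⟩ :=
        hD.inter_open_nonempty _ (hO.inter (GOTopology.isOpen_Ioi d)) h
      exact ⟨O ∩ Iio e, hO.inter (GOTopology.isOpen_Iio e), ⟨hdO, hed⟩, inter_subset_left,
        fun z hz hzd => hIoo d ⟨hdO, hd⟩ e ⟨heO, he⟩ z ⟨hzd, hz.2⟩⟩
    · exact ⟨O, hO, hdO, subset_rfl, fun z hz hzd => h ⟨z, hz, hzd⟩⟩
  have hsing : ({d} : Set Y) = W₁ ∩ W₂ := by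
    refine subset_antisymm (singleton_subset_iff.2 ⟨hdW₁, hdW₂⟩) fun z hz => ?_
    exact le_antisymm (not_lt.1 (hgt z hz.2)) (not_lt.1 (hlt z hz.1))
  exact hcon {d} ⟨hsing ▸ hW₁.inter hW₂, singleton_nonempty d, Or.inr ⟨d, hd, rfl⟩⟩
    (singleton_subset_iff.2 (hNU (hON hdO)))

theorem exists_gap_of_not_dense {μ : Cardinal.{u}} (hμ : ℵ₀ ≤ μ) (hY : IsCardCompact μ Y)
    {D : Set Y} (hD : Splits μ D) (hnd : ¬ Dense D) :
    ∃ p, (∃ l, IsLeftGap D l p) ∨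
      ∃ l : Yᵒᵈ, IsLeftGap (OrderDual.ofDual ⁻¹' D) l (OrderDual.toDual p) := by
  obtain ⟨p, hp⟩ := not_forall.1 hnd
  rw [mem_closure_iff_nhds] at hp
  push Not at hp
  obtain ⟨O, hO, hOD⟩ := hp
  exact ⟨p, hD.exists_gap hμ hY hO (disjoint_iff_inter_eq_empty.2 hOD)⟩

/-- A nonempty `μ`-compact generalized ordered space has a point of small `π`-character. -/
theorem exists_small_isLocalPiBase {κ μ : Cardinal.{u}} (hκ : κ.IsRegular) (hμ : ℵ₀ ≤ μ)
    (hμκ : Order.succ μ < κ) (hpow : ∀ θ < κ, ∀ c < μ, θ ^ c < κ) [Nonempty Y]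
    (hY : IsCardCompact μ Y) : ∃ (y : Y) (P : Set (Set Y)), #P < κ ∧ IsLocalPiBase P y := by
  obtain ⟨D, hDκ, hD⟩ := exists_small_closed_set hκ hμ hμκ hpow (between (Y := Y))
    fun S T _ _ => mk_pick_lt hκ.1 _
  by_cases hd : Dense D
  · exact ⟨Classical.arbitrary Y, _, mk_basicSets_lt hκ hDκ, isLocalPiBase_of_dense hd _⟩
  obtain ⟨p, ⟨l, hl⟩ | ⟨l, hl⟩⟩ :=
    exists_gap_of_not_dense hμ hY (splits_of_between_subset hD) hd
  · exact ⟨l, _, mk_basicSets_lt hκ hDκ, hl.isLocalPiBase⟩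
  · refine ⟨OrderDual.ofDual l, _, mk_basicSets_lt hκ hDκ, ?_⟩
    rw [← basicSets_dual]
    exact hl.isLocalPiBase
end

/-! ### Counting the members of an op-like base. -/

/-- Fewer than `κ` members of a `κ^op`-like base contain a given nonempty open set. -/
theorem mk_supersets_lt {κ : Cardinal.{u}} {X : Type u} [TopologicalSpace X] {A : Set (Set X)}
    (hA : IsTopologicalBasis A) (hop : IsOpLike κ A) {G : Set X} (hG : IsOpen G)
    (hne : G.Nonempty) : #{V | V ∈ A ∧ G ⊆ V} < κ := by
  obtain ⟨x, hx⟩ := hne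
  obtain ⟨B, hB, -, hBG⟩ := hA.exists_subset_of_mem_open hx hG
  refine lt_of_le_of_lt ?_ (not_le.1 (hop ⟨B, hB⟩))
  refine mk_le_of_injective (f := fun V : {V | V ∈ A ∧ G ⊆ V} =>
    (⟨⟨V.1, V.2.1⟩, hBG.trans V.2.2⟩ : {q : A // (⟨B, hB⟩ : A) ≤ q})) fun a b h => ?_
  exact Subtype.ext (congrArg (fun q => q.1.1) h)

/-- A `κ^op`-like base has fewer than `κ` elements if there is a `π`-base of size below `κ`. -/
theorem mk_base_lt {κ : Cardinal.{u}} (hκ : κ.IsRegular) {X : Type u} [TopologicalSpace X]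
    {A : Set (Set X)} (hA : IsTopologicalBasis A) (hop : IsOpLike κ A) {P : Set (Set X)}
    (hP : #P < κ) (hPX : ∀ x, IsLocalPiBase P x) : #A < κ := by
  rcases isEmpty_or_nonempty X with h | ⟨⟨x₀⟩⟩
  · exact (le_one_iff_subsingleton.2 inferInstance).trans_lt (one_lt_aleph0.trans_le hκ.1)
  -- The empty set may belong to the base but contains no member of `P`.
  have h : A ⊆ {∅} ∪ ⋃ W ∈ P, {V | V ∈ A ∧ W ⊆ V} := by
    intro V hV
    rcases V.eq_empty_or_nonempty with h | ⟨x, hx⟩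
    · exact Or.inl h
    · obtain ⟨W, hW, hWV⟩ := (hPX x).2 V ((hA.isOpen hV).mem_nhds hx)
      exact Or.inr (mem_biUnion hW ⟨hV, hWV⟩)
  refine (mk_le_mk_of_subset h).trans_lt (mk_union_lt hκ.1 ?_ (mk_biUnion_lt hκ hP fun W hW => ?_))
  · rw [mk_singleton]; exact one_lt_aleph0.trans_le hκ.1
  · exact mk_supersets_lt hA hop ((hPX x₀).1 W hW).1 ((hPX x₀).1 W hW).2

/-! ### Excluding gaps with a base of `Y × Z`. -/

section
variable {Y Z : Type u} [LinearOrder Y]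

/-- The members of `A` that contain a nonempty box with an interval with endpoints in `S` as
first side and a member of `Q` as second side. -/
def coarseSets (A : Set (Set (Y × Z))) (Q : Set (Set Z)) (S : Set Y) : Set (Set (Y × Z)) :=
  {V | V ∈ A ∧ ∃ a ∈ S, ∃ b ∈ S, ∃ W ∈ Q, (Ioo a b).Nonempty ∧ Ioo a b ×ˢ W ⊆ V}

/-- The convex component of `x` in the horizontal section of `V` at height `y`. -/
def sectionComponent (y : Z) (x : Y) (V : Set (Y × Z)) : Set Y :=
  ordConnectedComponent {z | (z, y) ∈ V} x

theorem mem_of_mem_sectionComponent {y : Z} {x z : Y} {V : Set (Y × Z)}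
    (h : z ∈ sectionComponent y x V) : (z, y) ∈ V :=
  ordConnectedComponent_subset (s := {z | (z, y) ∈ V}) h

/-- `c` lies in the component of `V` and bounds the component of `V'` from above. -/
def Dominates (y : Z) (x : Y) (V V' : Set (Y × Z)) (c : Y) : Prop :=
  c ∈ sectionComponent y x V ∧ ∀ z ∈ sectionComponent y x V', z ≤ c

/-- Points witnessing `Dominates` for data coming from `S`. -/
noncomputable def dominators (A : Set (Set (Y × Z))) (Q : Set (Set Z)) (y : Z) (S : Set Y) :
    Set Y :=
  ⋃ x ∈ S, ⋃ V ∈ coarseSets A Q S, ⋃ V' ∈ coarseSets A Q S, pick (Dominates y x V V')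

variable [TopologicalSpace Y] [TopologicalSpace Z] [GOTopology Y]

theorem mk_coarseSets_lt {κ : Cardinal.{u}} (hκ : κ.IsRegular) {A : Set (Set (Y × Z))}
    (hA : IsTopologicalBasis A) (hop : IsOpLike κ A) {Q : Set (Set Z)} (hQ : #Q < κ)
    (hQo : ∀ W ∈ Q, IsOpen W ∧ W.Nonempty) {S : Set Y} (hS : #S < κ) :
    #(coarseSets A Q S) < κ := by
  have h : coarseSets A Q S ⊆ ⋃ a ∈ S, ⋃ b ∈ S, ⋃ W ∈ Q,
      {V | (Ioo a b).Nonempty ∧ V ∈ A ∧ Ioo a b ×ˢ W ⊆ V} := by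
    rintro V ⟨hV, a, ha, b, hb, W, hW, hne, hsub⟩
    simp only [mem_iUnion]
    exact ⟨a, ha, b, hb, W, hW, hne, hV, hsub⟩
  refine (mk_le_mk_of_subset h).trans_lt (mk_biUnion_lt hκ hS fun a _ => mk_biUnion_lt hκ hS
    fun b _ => mk_biUnion_lt hκ hQ fun W hW => ?_)
  by_cases hne : (Ioo a b).Nonempty
  · refine (mk_le_mk_of_subset fun V hV => hV.2).trans_lt (mk_supersets_lt hA hop
      ((isOpen_Ioo_of_GOTopology a b).prod (hQo W hW).1) (hne.prod (hQo W hW).2))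
  · simpa [hne] using hκ.pos

theorem mk_dominators_lt {κ : Cardinal.{u}} (hκ : κ.IsRegular) {A : Set (Set (Y × Z))}
    (hA : IsTopologicalBasis A) (hop : IsOpLike κ A) {Q : Set (Set Z)} (hQ : #Q < κ)
    (hQo : ∀ W ∈ Q, IsOpen W ∧ W.Nonempty) (y : Z) {S : Set Y} (hS : #S < κ) :
    #(dominators A Q y S) < κ :=
  have h := mk_coarseSets_lt hκ hA hop hQ hQo hS
  mk_biUnion_lt hκ hS fun _ _ => mk_biUnion_lt hκ h fun _ _ => mk_biUnion_lt hκ h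
    fun _ _ => mk_pick_lt hκ.1 _

/-- Take `V` with section below `p`, and `V'` whose component contains `l`: any dominating `c` then
lies in `[l, p)`, which `D` misses. Components are anchored at a point `x` of `D`, not at `l`, so
that all data come from `D`. -/
theorem IsLeftGap.exists_dominates {D : Set Y} {l p : Y} (hgap : IsLeftGap D l p)
    {A : Set (Set (Y × Z))} (hA : IsTopologicalBasis A) {Q : Set (Set Z)} {y : Z}
    (hQ : IsLocalPiBase Q y) :
    ∃ x ∈ D, ∃ V ∈ coarseSets A Q D, ∃ V' ∈ coarseSets A Q D,
      (∃ c, Dominates y x V V' c) ∧ ∀ c, Dominates y x V V' c → c ∉ D := by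
  have hcoarse : ∀ V ∈ A, (l, y) ∈ V → V ∈ coarseSets A Q D := by
    intro V hV hly
    obtain ⟨N, hN, M, hM, hNM⟩ := mem_nhds_prod_iff.1 ((hA.isOpen hV).mem_nhds hly)
    obtain ⟨a, ha, b, hb, -, -, hne, hsub⟩ := hgap.exists_Ioo hN
    obtain ⟨W, hW, hWM⟩ := hQ.2 M hM
    exact ⟨hV, a, ha, b, hb, W, hW, hne, (prod_mono hsub hWM).trans hNM⟩
  have hsec : ∀ V ∈ A, (l, y) ∈ V → {z | (z, y) ∈ V} ∈ 𝓝 l := fun V hV hly =>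
    (Continuous.prodMk_left y).continuousAt.preimage_mem_nhds ((hA.isOpen hV).mem_nhds hly)
  have hbase : ∀ U ∈ 𝓝 l, ∃ V ∈ A, (l, y) ∈ V ∧ ∀ z, (z, y) ∈ V → z ∈ U := by
    intro U hU
    obtain ⟨O, hOU, hO, hlO⟩ := mem_nhds_iff.1 hU
    obtain ⟨V, hV, hlV, hVO⟩ := hA.exists_subset_of_mem_open
      (show (l, y) ∈ O ×ˢ Set.univ from ⟨hlO, mem_univ _⟩) (hO.prod isOpen_univ)
    exact ⟨V, hV, hlV, fun z hz => hOU (hVO hz).1⟩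
  have hlast : ∀ V V' : Set (Y × Z), ∀ x, (∀ z, (z, y) ∈ V → z < p) →
      l ∈ sectionComponent y x V' → ∀ c, Dominates y x V V' c → c ∉ D :=
    fun V V' x hV hl c hc hcD => absurd
      (hgap.2.1 c hcD (hV c (mem_of_mem_sectionComponent hc.1))) (not_lt.2 (hc.2 l hl))
  obtain ⟨V, hV, hlV, hVp⟩ := hbase _ ((GOTopology.isOpen_Iio p).mem_nhds hgap.1)
  obtain ⟨O, hO, hOV, hOc⟩ := GOTopology.exists_ordConnected l _ (hsec V hV hlV)
  -- If `O` reaches some `z` beyond `l`, then `c = z` dominates a member with section below `z`.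
  -- Otherwise `l` is the greatest point of `O`, and a member with section inside `O` is dominated
  -- at `l` by itself.
  by_cases hmax : ∃ z ∈ O, l < z
  · obtain ⟨z, hzO, hlz⟩ := hmax
    obtain ⟨V', hV', hlV', hVz⟩ := hbase _ ((GOTopology.isOpen_Iio z).mem_nhds hlz)
    obtain ⟨x, hx, hxl, hxU⟩ := hgap.2.2 _ (Filter.inter_mem hO (hsec V' hV' hlV'))
    have hx' : Icc x l ⊆ {z | (z, y) ∈ V'} := hxU.trans inter_subset_right
    have hxO : x ∈ O := (hxU (left_mem_Icc.2 hxl.le)).1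
    refine ⟨x, hx, V, hcoarse V hV hlV, V', hcoarse V' hV' hlV', ⟨z, ?_, fun w hw => ?_⟩,
      hlast V V' x hVp ?_⟩
    · rw [sectionComponent, mem_ordConnectedComponent]
      exact (hOc.uIcc_subset hxO hzO).trans hOV
    · exact (hVz w (mem_of_mem_sectionComponent hw)).le
    · rw [sectionComponent, mem_ordConnectedComponent, uIcc_of_le hxl.le]
      exact hx'
  · push Not at hmax
    obtain ⟨V', hV', hlV', hVO⟩ := hbase O hO
    obtain ⟨x, hx, hxl, hxU⟩ := hgap.2.2 _ (hsec V' hV' hlV')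
    have hl : l ∈ sectionComponent y x V' := by
      rw [sectionComponent, mem_ordConnectedComponent, uIcc_of_le hxl.le]
      exact hxU
    exact ⟨x, hx, V', hcoarse V' hV' hlV', V', hcoarse V' hV' hlV',
      ⟨l, hl, fun w hw => hmax w (hVO w (mem_of_mem_sectionComponent hw))⟩,
      hlast V' V' x (fun z hz => hVp z (hOV (hVO z hz))) hl⟩

/-- The data of `IsLeftGap.exists_dominates` use only five points of `D`, so the closure of `D`
captures a dominating point. -/
theorem not_isLeftGap {μ : Cardinal.{u}} (hμ : ℵ₀ ≤ μ) {D : Set Y} {l p : Y}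
    {A : Set (Set (Y × Z))} (hA : IsTopologicalBasis A) {Q : Set (Set Z)} {y : Z}
    (hQ : IsLocalPiBase Q y) (hD : ∀ S ⊆ D, #S < μ → dominators A Q y S ⊆ D) :
    ¬ IsLeftGap D l p := by
  intro hgap
  obtain ⟨x, hx, V, ⟨hV, a, ha, b, hb, W, hW, hne, hsub⟩, V', ⟨hV', a', ha', b', hb', W', hW',
    hne', hsub'⟩, hc, hcD⟩ := hgap.exists_dominates hA hQ
  have hS := hD {x, a, b, a', b'} (by
    rintro _ (rfl | rfl | rfl | rfl | rfl) <;> assumption)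
    ((lt_aleph0_iff_set_finite.2 (toFinite _)).trans_le hμ)
  obtain ⟨c, hc, hdom⟩ := exists_of_pick_subset (p := Dominates y x V V') (D := D) (by
    refine subset_trans (fun z hz => ?_) hS
    simp only [dominators, mem_iUnion]
    exact ⟨x, by simp, V, ⟨hV, a, by simp, b, by simp, W, hW, hne, hsub⟩, V',
      ⟨hV', a', by simp, b', by simp, W', hW', hne', hsub'⟩, hz⟩) hc
  exact hcD c hdom hc

/-- If `Y × Z` has a `κ^op`-like base, `Y` is a `μ`-compact generalized ordered space, and `Z` has
a point of small `π`-character, then `Y` has small `π`-weight. -/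
theorem exists_small_piBase {κ μ : Cardinal.{u}} (hκ : κ.IsRegular) (hμ : ℵ₀ ≤ μ)
    (hμκ : Order.succ μ < κ) (hpow : ∀ θ < κ, ∀ c < μ, θ ^ c < κ) (hY : IsCardCompact μ Y)
    {A : Set (Set (Y × Z))} (hA : IsTopologicalBasis A) (hop : IsOpLike κ A)
    {Q : Set (Set Z)} {y : Z} (hQκ : #Q < κ) (hQ : IsLocalPiBase Q y) :
    ∃ P : Set (Set Y), #P < κ ∧ ∀ x, IsLocalPiBase P x := by
  have hμκ' : μ < κ := (Order.lt_succ μ).trans hμκ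
  let dualDominators : Set Y → Set Y := dominators (Y := Yᵒᵈ) A Q y
  obtain ⟨D, hDκ, hD⟩ := exists_small_closed_set hκ hμ hμκ hpow
    (fun S T : Set Y => between S T ∪ (dominators A Q y S ∪ dualDominators S))
    fun S T hS _ => mk_union_lt hκ.1 (mk_pick_lt hκ.1 _)
      (mk_union_lt hκ.1 (mk_dominators_lt hκ hA hop hQκ hQ.1 y (hS.trans hμκ'))
        (mk_dominators_lt (Y := Yᵒᵈ) hκ hA hop hQκ hQ.1 y (hS.trans hμκ')))
  have hself : ∀ S ⊆ D, #S < μ → dominators A Q y S ∪ dualDominators S ⊆ D :=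
    fun S hS hSμ => subset_union_right.trans (hD S S hS hS hSμ hSμ)
  refine ⟨basicSets D, mk_basicSets_lt hκ hDκ, isLocalPiBase_of_dense ?_⟩
  by_contra hnd
  obtain ⟨p, ⟨l, hl⟩ | ⟨l, hl⟩⟩ := exists_gap_of_not_dense hμ hY (splits_of_between_subset
    fun S T hS hT hSμ hTμ => subset_union_left.trans (hD S T hS hT hSμ hTμ)) hnd
  · exact not_isLeftGap hμ hA hQ
      (fun S hS hSμ => subset_union_left.trans (hself S hS hSμ)) hl
  · exact not_isLeftGap (Y := Yᵒᵈ) hμ hA hQ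
      (fun S hS hSμ => subset_union_right.trans (hself S hS hSμ)) hl
end

/-! ### Boxes in products. -/

section
variable {ι : Type u} {X : ι → Type u}

/-- The nonempty boxes with finitely many constrained sides, these being taken from `P`. -/
def boxes (P : ∀ i, Set (Set (X i))) : Set (Set (∀ i, X i)) :=
  {U | U.Nonempty ∧ ∃ s : Finset (Σ i, P i), U = {x | ∀ e ∈ s, x e.1 ∈ e.2.1}}

theorem mk_boxes_lt {κ : Cardinal.{u}} (hκ : κ.IsRegular) (hκ' : ℵ₀ < κ) (hι : #ι < κ)
    {P : ∀ i, Set (Set (X i))} (hP : ∀ i, #(P i) < κ) : #(boxes P) < κ := by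
  classical
  have hsig : #(Σ i, P i) < κ := by
    rw [mk_sigma]
    exact sum_lt_of_isRegular hκ hι hP
  have h : boxes P ⊆
      range fun s : List (Σ i, P i) => {x : ∀ i, X i | ∀ e ∈ s, x e.1 ∈ e.2.1} := by
    rintro U ⟨-, s, rfl⟩
    exact ⟨s.toList, by simp⟩
  exact (mk_le_mk_of_subset h).trans_lt (mk_range_le.trans_lt
    ((mk_list_le_max _).trans_lt (max_lt hκ' hsig)))

theorem isLocalPiBase_boxes [∀ i, TopologicalSpace (X i)] {P : ∀ i, Set (Set (X i))}
    {x : ∀ i, X i} (hP : ∀ i, IsLocalPiBase (P i) (x i)) : IsLocalPiBase (boxes P) x := by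
  classical
  refine ⟨?_, fun U hU => ?_⟩
  · rintro U ⟨hne, s, rfl⟩
    refine ⟨?_, hne⟩
    have : {x : ∀ i, X i | ∀ e ∈ s, x e.1 ∈ e.2.1} =
        ⋂ e ∈ s, (fun x : ∀ i, X i => x e.1) ⁻¹' e.2.1 := by
      ext; simp
    rw [this]
    exact isOpen_biInter_finset fun e _ =>
      ((hP e.1).1 _ e.2.2).1.preimage (continuous_apply e.1)
  · rw [nhds_pi, Filter.mem_pi] at hU
    obtain ⟨F, hF, t, ht, htU⟩ := hU
    choose W hW hWt using fun i => (hP i).2 (t i) (ht i)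
    refine ⟨{x | ∀ e ∈ hF.toFinset.image fun i => (⟨i, W i, hW i⟩ : Σ i, P i), x e.1 ∈ e.2.1},
      ⟨?_, _, rfl⟩, fun z hz => htU fun i hi => hWt i ?_⟩
    · choose z hz using fun i => ((hP i).1 (W i) (hW i)).2
      refine ⟨z, fun e he => ?_⟩
      obtain ⟨i, -, rfl⟩ := Finset.mem_image.1 he
      exact hz i
    · exact hz ⟨i, W i, hW i⟩ (Finset.mem_image.2 ⟨i, hF.mem_toFinset.2 hi, rfl⟩)
end

/-! ### Noetherian type and the theorem. -/

theorem HasOpLikeBase.of_homeomorph {κ : Cardinal.{u}} {X Y : Type u} [TopologicalSpace X]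
    [TopologicalSpace Y] (h : HasOpLikeBase κ X) (e : X ≃ₜ Y) : HasOpLikeBase κ Y := by
  obtain ⟨B, hB, hop⟩ := h
  refine ⟨preimage e.symm '' B, hB.isInducing e.symm.isInducing, ?_⟩
  rintro ⟨_, p, hp, rfl⟩ hκ
  refine hop ⟨p, hp⟩ (hκ.trans ?_)
  have hpre : ∀ U : Set X, e ⁻¹' (e.symm ⁻¹' U) = U := fun U => by ext; simp
  refine mk_le_of_injective (f := fun q => ⟨⟨e ⁻¹' q.1.1, ?_⟩, ?_⟩) ?_
  · obtain ⟨⟨_, q, hq, rfl⟩, -⟩ := q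
    rwa [hpre]
  · have h : e ⁻¹' (e.symm ⁻¹' p) ⊆ e ⁻¹' q.1.1 := preimage_mono q.2
    rwa [hpre] at h
  · intro a b hab
    exact Subtype.ext (Subtype.ext (e.surjective.preimage_injective
      (congrArg (fun q => q.1.1) hab)))

theorem noetherianType_congr {X Y : Type u} [TopologicalSpace X] [TopologicalSpace Y]
    (e : X ≃ₜ Y) : noetherianType X = noetherianType Y :=
  congrArg sInf (Set.ext fun _ => and_congr_right fun _ =>
    ⟨fun h => h.of_homeomorph e, fun h => h.of_homeomorph e.symm⟩)

theorem noetherianType_lt_of_base {κ : Cardinal.{u}} (hκ : ℵ₀ < κ) (hlim : Order.IsSuccLimit κ)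
    {X : Type u} [TopologicalSpace X] {A : Set (Set X)} (hA : IsTopologicalBasis A)
    (hAκ : #A < κ) : noetherianType X < κ := by
  refine lt_of_le_of_lt (csInf_le' ⟨le_max_left ℵ₀ (Order.succ #A), A, hA, fun p h => ?_⟩)
    (max_lt hκ (hlim.succ_lt hAκ))
  exact absurd ((le_max_right _ _).trans (h.trans (mk_subtype_le _)))
    (not_le.2 (Order.lt_succ _))

/-- A `κ^op`-like base of a product of fewer than `κ` many `μ`-compact generalized ordered spaces
has fewer than `κ` elements. -/
theorem mk_opLike_base_pi_lt {κ μ : Cardinal.{u}} (hκ : κ.IsRegular) (hμ : ℵ₀ ≤ μ)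
    (hμκ : Order.succ μ < κ) (hpow : ∀ θ < κ, ∀ c < μ, θ ^ c < κ) {ι : Type u} {X : ι → Type u}
    [∀ i, TopologicalSpace (X i)] (hι : #ι < κ) (hGO : ∀ i, IsGOSpace (X i))
    (hX : ∀ i, IsCardCompact μ (X i)) {A : Set (Set (∀ i, X i))} (hA : IsTopologicalBasis A)
    (hop : IsOpLike κ A) : #A < κ := by
  classical
  have hκ' : ℵ₀ < κ := hμ.trans_lt ((Order.lt_succ μ).trans hμκ)
  rcases isEmpty_or_nonempty (∀ i, X i) with hE | ⟨⟨x₀⟩⟩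
  · exact mk_base_lt hκ hA hop (P := ∅) (by simpa using hκ.pos) fun x => isEmptyElim x
  have (i : ι) : Nonempty (X i) := ⟨x₀ i⟩
  choose ord hord using fun i => (hGO i).exists_linearOrder
  choose y Q hQκ hQ using fun i => exists_small_isLocalPiBase hκ hμ hμκ hpow (hX i)
  have hP : ∀ i, ∃ P : Set (Set (X i)), #P < κ ∧ ∀ x, IsLocalPiBase P x := by
    intro i
    -- The base is transported to `X i` times the product of the other factors, where the points `y
    -- j` give small `π`-character.
    obtain ⟨B, hB, hBop⟩ := HasOpLikeBase.of_homeomorph ⟨A, hA, hop⟩ (Homeomorph.piSplitAt i X)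
    exact exists_small_piBase hκ hμ hμκ hpow (hX i) hB hBop
      (mk_boxes_lt hκ hκ' ((mk_subtype_le _).trans_lt hι) fun j : {j // j ≠ i} => hQκ j)
      (isLocalPiBase_boxes fun j => hQ j)
  choose P hPκ hP using hP
  exact mk_base_lt hκ hA hop (mk_boxes_lt hκ hκ' hι hPκ)
    fun x => isLocalPiBase_boxes fun i => hP i (x i)

theorem noetherianType_pi_ne {κ μ : Cardinal.{u}} (hκ : IsWeaklyInaccessible κ) (hμ : ℵ₀ ≤ μ)
    (hμκ : μ < κ) (hpow : ∀ θ < κ, ∀ c < μ, θ ^ c < κ) {ι : Type u} {X : ι → Type u}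
    [∀ i, TopologicalSpace (X i)] (hι : #ι < κ) (hGO : ∀ i, IsGOSpace (X i))
    (hX : ∀ i, IsCardCompact μ (X i)) : noetherianType (∀ i, X i) ≠ κ := by
  intro h
  obtain ⟨A, hA, hop⟩ := (noetherianType_mem (∀ i, X i)).2
  rw [h] at hop
  exact (noetherianType_lt_of_base hκ.1 hκ.2.2 hA (mk_opLike_base_pi_lt hκ.2.1 hμ
    (hκ.2.2.succ_lt hμκ) hpow hι hGO hX hA hop)).ne h

theorem IsCardCompact.mono {μ ν : Cardinal.{u}} (h : μ ≤ ν) {X : Type u} [TopologicalSpace X]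
    (hX : IsCardCompact μ X) : IsCardCompact ν X := fun C hC hCu =>
  let ⟨D, hDC, hD, hDμ⟩ := hX C hC hCu
  ⟨D, hDC, hD, hDμ.trans_le h⟩

theorem isCardCompact_aleph_one {X : Type u} [TopologicalSpace X] [LindelofSpace X] :
    IsCardCompact ℵ₁ X := by
  intro C hC hCu
  obtain ⟨r, hr, hru⟩ := isLindelof_univ.elim_countable_subcover (fun U : C => U.1)
    (fun U => hC U U.2) (by rw [← hCu, sUnion_eq_iUnion])
  refine ⟨Subtype.val '' r, by rintro _ ⟨U, -, rfl⟩; exact U.2, eq_univ_of_forall fun x => ?_,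
    (le_aleph0_iff_set_countable.2 (hr.image _)).trans_lt aleph0_lt_aleph_one⟩
  obtain ⟨U, hU, hx⟩ := mem_iUnion₂.1 (hru (mem_univ x))
  exact ⟨U, mem_image_of_mem _ hU, hx⟩

/-- If `κ ≤ μ`, then `2 ^< μ`, being below `μ`, is itself an admissible exponent, against Cantor's
theorem. -/
theorem lt_of_two_powerlt_lt {κ μ : Cardinal.{u}} (h : 2 ^< μ < κ) : μ < κ := by
  by_contra! hκμ
  exact absurd (le_powerlt 2 (h.trans_le hκμ)) (not_le.2 (cantor _))

theorem power_lt_of_lt_aleph0 {κ θ c : Cardinal.{u}} (hκ : ℵ₀ < κ) (hθ : θ < κ) (hc : c < ℵ₀) :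
    θ ^ c < κ := by
  rcases lt_or_ge θ ℵ₀ with h | h
  · exact (power_lt_aleph0 h hc).trans hκ
  · obtain ⟨n, rfl⟩ := lt_aleph0.1 hc
    exact (power_nat_le h).trans_lt hθ

theorem Cardinal.IsInaccessible.power_lt {κ θ c : Cardinal.{u}} (hκ : κ.IsInaccessible)
    (hθ : θ < κ) (hc : c < κ) : θ ^ c < κ := by
  refine ((power_le_power_right (cantor θ).le).trans_eq (power_mul).symm).trans_lt
    (hκ.isStrongLimit.isStrongPrelimit (mul_lt_of_lt hκ.isRegular.1 hθ hc))

theorem mainTheorem9 :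
    (∀ κ μ : Cardinal.{u}, IsWeaklyInaccessible κ →
      (∀ θ : Cardinal.{u}, θ < κ → θ ^< μ < κ) →
      ∀ (ι : Type u) (X : ι → Type u) [∀ i, TopologicalSpace (X i)],
        #ι < κ → (∀ i, IsGOSpace (X i)) → (∀ i, IsCardCompact μ (X i)) →
          noetherianType (∀ i, X i) ≠ κ) ∧
    (∀ (X : Type u) [TopologicalSpace X],
      IsGOSpace X → LindelofSpace X → ¬ (noetherianType X).IsInaccessible) := by
  constructor
  · intro κ μ hκ hpow ι X _ hι hGO hX
    have hμκ : μ < κ := lt_of_two_powerlt_lt (hpow 2 (ofNat_lt_aleph0.trans hκ.1))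
    -- `μ` may be finite, so it is replaced by `max μ ℵ₀`; the extra finite exponents are harmless.
    refine noetherianType_pi_ne hκ (le_max_right μ ℵ₀) (max_lt hμκ hκ.1) (fun θ hθ c hc => ?_)
      hι hGO fun i => (hX i).mono (le_max_left _ _)
    rcases lt_max_iff.1 hc with h | h
    · exact (le_powerlt θ h).trans_lt (hpow θ hθ)
    · exact power_lt_of_lt_aleph0 hκ.1 hθ h
  · intro X _ hGO _ hin
    have hω₁ : ℵ₁ < noetherianType X := by
      rw [← succ_aleph0]
      exact hin.isSuccLimit.succ_lt hin.1
    refine noetherianType_pi_ne (ι := PUnit.{u + 1}) (X := fun _ => X) (μ := ℵ₁)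
      ⟨hin.1, hin.isRegular, hin.isSuccLimit⟩
      (aleph0_lt_aleph_one.le) hω₁ (fun θ hθ c hc => hin.power_lt hθ (hc.trans hω₁))
      (by simpa using one_lt_aleph0.trans hin.1) (fun _ => hGO)
      (fun _ => isCardCompact_aleph_one) ?_
    exact noetherianType_congr (Homeomorph.funUnique PUnit X)
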